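/- Let $1\le k\le n$ be integers. Let $G_{n,k}$ be the Grassmannian of $k$-dimensional linear subspaces of $\mathbb R^n$ with its rotation-invariant (Haar) probability measure $\mu_{n,k}$, and let $M_{n,k}$ be the Grassmannian of $k$-dimensional affine subspaces of $\mathbb R^n$ with the rigid-motion invariant measure $$\nu_{n,k}(A)=\int_{G_{n,k}}\bigl|\{x\in E^{\perp}: x+E\in A\}\bigr|\,d\mu_{n,k}(E),$$ where $|\cdot|$ is Lebesgue measure on $E^\perp$. For a measurable function $f$ on $\mathbb R^n$, a real number $p\neq 0$ and $F\in M_{n,k}$ put $\|f|_F\|_p=\bigl(\int_F|f|^p\bigr)^{1/p}\in[0,\infty]$, the integral being with respect to $k$-dimensional Lebesgue measure on $F$. **Theorem.** Let $m$ be a positive integer, and let $p_i\ne 0$ and $\alpha_i$, $i=1,\dots,m$, be real numbers with $\sum_{i=1}^m \frac{\alpha_i}{p_i}=n+1$. Let $f_1,\dots,f_m$ be bounded measurable real- or complex-valued functions on $\mathbb R^n$ with $f_i\in L^{p_i}(\mathbb R^n)$, that is, $\int_{\mathbb R^n}|f_i|^{p_i}<\infty$. Define $$\tilde I(f_1,\dots,f_m):=\int_{M_{n,k}}\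 \prod_{i=1}^m \|f_i|_F\|_{p_i}^{\alpha_i}\ d\nu_{n,k}(F)\in[0,\infty],$$ with the conventions $0^{a}=\infty$ and $\infty^{a}=0$ for $a<0$, $0^0=\infty^0=1$, and $0\cdot\infty=0$. If $\tilde I(f_1,\dots,f_m)<\infty$, then for every volume-preserving affine transformation $g$ of $\mathbb R^n$, $$\tilde I(g\cdot f_1,\dots,g\cdot f_m)=\tilde I(f_1,\dots,f_m),\qquad\text{where } (g\cdot f_i)(t)=f_i(g^{-1}t).$$ -/

import Mathlib

open MeasureTheory Set Topology
open scoped ENNReal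

noncomputable section

namespace AffineGrass

/-- Euclidean space `ℝⁿ`. -/
abbrev Space (n : ℕ) : Type := EuclideanSpace ℝ (Fin n)

/-! ### The Grassmannian of `k`-dimensional linear subspaces -/

/-- The Grassmannian `G_{n,k}` of `k`-dimensional linear subspaces of `ℝⁿ`. -/
def Grassmannian (n k : ℕ) : Type :=
  {E : Submodule ℝ (Space n) // Module.finrank ℝ E = k}

namespace Grassmannian

variable {n k : ℕ}

/-- The orthogonal projection of `ℝⁿ` onto `E`. -/
def proj (E : Grassmannian n k) : Space n →L[ℝ] Space n := E.1.starProjection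

/-- The usual topology: subspaces are close when their orthogonal projections are. -/
instance : TopologicalSpace (Grassmannian n k) :=
  TopologicalSpace.induced proj inferInstance

instance : MeasurableSpace (Grassmannian n k) := borel _

instance : BorelSpace (Grassmannian n k) := ⟨rfl⟩

lemma continuous_proj : Continuous (proj : Grassmannian n k → _) := continuous_induced_dom

end Grassmannian

/-- The orthogonal group `O(n)`. -/
abbrev OrthGroup (n : ℕ) : Type := Matrix.orthogonalGroup (Fin n) ℝ

section OrthGroup

variable {n : ℕ}

instance : MeasurableSpace (OrthGroup n) := borel _

instance : BorelSpace (OrthGroup n) := ⟨rfl⟩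

instance : CompactSpace (OrthGroup n) := by
  refine (isCompact_iff_compactSpace (X := Matrix (Fin n) (Fin n) ℝ)
    (s := (Matrix.orthogonalGroup (Fin n) ℝ : Set (Matrix (Fin n) (Fin n) ℝ)))).1 ?_
  have hK : IsCompact (X := Matrix (Fin n) (Fin n) ℝ)
      (Set.univ.pi fun _ => Set.univ.pi fun _ => Set.Icc (-1 : ℝ) 1) :=
    isCompact_univ_pi fun _ => isCompact_univ_pi fun _ => isCompact_Icc
  refine hK.of_isClosed_subset (isClosed_unitary (R := Matrix (Fin n) (Fin n) ℝ)) ?_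
  intro U hU i _ j _
  have := entry_norm_bound_of_unitary hU i j
  rw [Real.norm_eq_abs, abs_le] at this
  exact this

/-- The Haar probability measure of `O(n)`. -/
def orthHaar (n : ℕ) : Measure (OrthGroup n) := Measure.haarMeasure ⊤

instance : IsProbabilityMeasure (orthHaar n) :=
  ⟨Measure.haarMeasure_self (K₀ := (⊤ : TopologicalSpace.PositiveCompacts (OrthGroup n)))⟩

/-- The linear isometry `x ↦ U x` of `ℝⁿ` given by an orthogonal matrix `U`. -/
def orthAct (U : OrthGroup n) : Space n ≃ₗᵢ[ℝ] Space n :=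
  Unitary.linearIsometryEquiv
    ⟨Matrix.toEuclideanCLM (n := Fin n) (𝕜 := ℝ) U.1, by
      rw [Unitary.mem_iff]
      constructor
      · rw [← map_star, ← map_mul, (Unitary.mem_iff.1 U.2).1, map_one]
      · rw [← map_star, ← map_mul, (Unitary.mem_iff.1 U.2).2, map_one]⟩

lemma orthAct_apply (U : OrthGroup n) (x : Space n) :
    orthAct U x = Matrix.toEuclideanCLM (n := Fin n) (𝕜 := ℝ) U.1 x := rfl

end OrthGroup

namespace Grassmannian

variable {n k : ℕ}

/-- The image `U E` of a subspace `E` under an orthogonal matrix `U`. -/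
def rotate (U : OrthGroup n) (E : Grassmannian n k) : Grassmannian n k :=
  ⟨E.1.map (orthAct U).toLinearEquiv.toLinearMap, by
    rw [LinearEquiv.finrank_map_eq]; exact E.2⟩

/-- The coordinate subspace `ℝ e₁ ⊕ ⋯ ⊕ ℝ e_k`. -/
def coord (h : k ≤ n) : Grassmannian n k :=
  ⟨Submodule.span ℝ (Set.range fun i : Fin k =>
      EuclideanSpace.basisFun (Fin n) ℝ (Fin.castLE h i)), by
    have hli : LinearIndependent ℝ fun i : Fin k =>
        EuclideanSpace.basisFun (Fin n) ℝ (Fin.castLE h i) :=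
      (EuclideanSpace.basisFun (Fin n) ℝ).orthonormal.linearIndependent.comp _
        (Fin.castLE_injective h)
    simpa using finrank_span_eq_card hli⟩

/-- The Haar probability measure `μ_{n,k}` on `G_{n,k}`: the law of `U (ℝ e₁ ⊕ ⋯ ⊕ ℝ e_k)` for a
Haar distributed `U ∈ O(n)`. -/
def haar (h : k ≤ n) : Measure (Grassmannian n k) :=
  (orthHaar n).map fun U => rotate U (coord h)

lemma measurable_proj : Measurable (proj : Grassmannian n k → _) :=
  continuous_proj.measurable

lemma measurable_of_proj {X : Type*} [MeasurableSpace X] {φ : X → Grassmannian n k}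
    (hφ : Measurable fun x => proj (φ x)) : Measurable φ := by
  refine measurable_of_isOpen fun s hs => ?_
  obtain ⟨t, ht, rfl⟩ := isOpen_induced_iff.1 hs
  exact hφ ht.measurableSet

lemma proj_rotate (U : OrthGroup n) (E : Grassmannian n k) :
    proj (rotate U E) = (Matrix.toEuclideanCLM (n := Fin n) (𝕜 := ℝ) U.1).comp
      ((proj E).comp (Matrix.toEuclideanCLM (n := Fin n) (𝕜 := ℝ) (star U.1))) := by
  ext1 x
  have hs : Matrix.toEuclideanCLM (n := Fin n) (𝕜 := ℝ) (star U.1) x = (orthAct U).symm x := by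
    rw [map_star]; rfl
  rw [ContinuousLinearMap.comp_apply, ContinuousLinearMap.comp_apply, hs]
  exact Submodule.starProjection_map_apply (orthAct U) E.1 x

lemma continuous_rotate (E : Grassmannian n k) : Continuous fun U => rotate U E := by
  refine continuous_induced_rng.2 ?_
  have hc : Continuous (Matrix.toEuclideanCLM (n := Fin n) (𝕜 := ℝ)) :=
    LinearMap.continuous_of_finiteDimensional
      (Matrix.toEuclideanCLM (n := Fin n) (𝕜 := ℝ)).toAlgEquiv.toLinearMap
  have : (proj ∘ fun U => rotate U E) = fun U : OrthGroup n =>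
      (Matrix.toEuclideanCLM (n := Fin n) (𝕜 := ℝ) U.1).comp
      ((proj E).comp (Matrix.toEuclideanCLM (n := Fin n) (𝕜 := ℝ) (star U.1))) :=
    funext fun U => proj_rotate U E
  rw [this]
  have h1 := hc.comp (continuous_subtype_val (p := (· ∈ Matrix.orthogonalGroup (Fin n) ℝ)))
  have h2 := hc.comp (continuous_star.comp
    (continuous_subtype_val (p := (· ∈ Matrix.orthogonalGroup (Fin n) ℝ))))
  exact h1.clm_comp (continuous_const.clm_comp h2)

lemma rotate_mul (U V : OrthGroup n) (E : Grassmannian n k) :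
    rotate (U * V) E = rotate U (rotate V E) := by
  refine Subtype.ext ?_
  simp only [rotate]
  rw [← Submodule.map_comp]
  congr 1
  ext1 x
  simp [orthAct_apply]

instance (h : k ≤ n) : IsProbabilityMeasure (haar h) :=
  Measure.isProbabilityMeasure_map (continuous_rotate _).measurable.aemeasurable

lemma measurable_rotate (U : OrthGroup n) :
    Measurable (rotate U : Grassmannian n k → Grassmannian n k) := by
  refine measurable_of_proj ?_
  simp only [proj_rotate]
  exact (continuous_const.clm_comp (continuous_proj.clm_comp continuous_const)).measurable

/-- `μ_{n,k}` is invariant under rotations. -/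
lemma map_rotate_haar (h : k ≤ n) (U : OrthGroup n) : (haar h).map (rotate U) = haar h := by
  have h1 := (continuous_rotate (coord h)).measurable
  have hU : (orthHaar n).map (U * ·) = orthHaar n := by
    unfold orthHaar; exact map_mul_left_eq_self _ U
  rw [haar, Measure.map_map (measurable_rotate U) h1]
  conv_rhs => rw [← hU, Measure.map_map h1 (continuous_const_mul U).measurable]
  congr 1
  ext1 V
  exact (rotate_mul U V _).symm

end Grassmannian

/-! ### The affine Grassmannian of `k`-dimensional affine subspaces -/

/-- The affine Grassmannian `M_{n,k}` of `k`-dimensional affine subspaces of `ℝⁿ`. -/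
def AffineGrassmannian (n k : ℕ) : Type :=
  {F : AffineSubspace ℝ (Space n) //
    (F : Set (Space n)).Nonempty ∧ Module.finrank ℝ F.direction = k}

namespace AffineGrassmannian

variable {n k : ℕ}

/-- The linear subspace parallel to `F`. -/
def dir (F : AffineGrassmannian n k) : Grassmannian n k := ⟨F.1.direction, F.2.2⟩

/-- The point of `F` closest to the origin. -/
def foot (F : AffineGrassmannian n k) : Space n :=
  haveI : Nonempty F.1 := F.2.1.to_subtype
  EuclideanGeometry.orthogonalProjection F.1 0

/-- The usual topology: affine subspaces are close when their directions and their points closest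
to the origin are. -/
instance : TopologicalSpace (AffineGrassmannian n k) :=
  TopologicalSpace.induced (fun F => (F.dir, F.foot)) inferInstance

instance : MeasurableSpace (AffineGrassmannian n k) := borel _

instance : BorelSpace (AffineGrassmannian n k) := ⟨rfl⟩

/-- The affine subspace `z + E`. -/
def mk (E : Grassmannian n k) (z : Space n) : AffineGrassmannian n k :=
  ⟨AffineSubspace.mk' z E.1, AffineSubspace.mk'_nonempty z E.1, by
    rw [AffineSubspace.direction_mk']; exact E.2⟩

/-- The rigid-motion invariant measure `ν_{n,k}` on `M_{n,k}`: the mixture over `E ∼ μ_{n,k}` of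
the laws of `x + E` for `x` distributed according to Lebesgue measure on `E^⊥`, so that
`ν_{n,k}(A) = ∫ |{x ∈ E^⊥ : x + E ∈ A}| dμ_{n,k}(E)` (see `measure_apply`). -/
def measure (h : k ≤ n) : Measure (AffineGrassmannian n k) :=
  (Grassmannian.haar h).bind fun E => (volume : Measure E.1ᗮ).map fun x : E.1ᗮ => mk E (x : Space n)

lemma dir_mk (E : Grassmannian n k) (z : Space n) : (mk E z).dir = E :=
  Subtype.ext (AffineSubspace.direction_mk' z E.1)

lemma foot_mk (E : Grassmannian n k) (z : Space n) :
    (mk E z).foot = z - Grassmannian.proj E z := by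
  have : Nonempty (mk E z).1 := (mk E z).2.1.to_subtype
  have h := EuclideanGeometry.inter_eq_singleton_orthogonalProjection
    (s := (mk E z).1) (0 : Space n)
  have hd : (mk E z).1.direction = E.1 := AffineSubspace.direction_mk' z E.1
  have hm : z - Grassmannian.proj E z ∈ ((mk E z).1 : Set (Space n)) ∩
      AffineSubspace.mk' (0 : Space n) (mk E z).1.directionᗮ := by
    rw [hd]
    refine ⟨?_, ?_⟩
    · change _ ∈ AffineSubspace.mk' z E.1
      simp [AffineSubspace.mem_mk', Grassmannian.proj]
    · simp only [SetLike.mem_coe, AffineSubspace.mem_mk', vsub_eq_sub, sub_zero]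
      exact Submodule.sub_starProjection_mem_orthogonal z
  rw [h] at hm
  exact hm.symm

lemma measurable_mk :
    Measurable fun q : Grassmannian n k × Space n => mk q.1 q.2 := by
  refine measurable_of_isOpen fun s hs => ?_
  obtain ⟨t, ht, rfl⟩ := isOpen_induced_iff.1 hs
  have hc : Continuous fun q : Grassmannian n k × Space n => (q.1, q.2 - q.1.proj q.2) :=
    continuous_fst.prodMk (continuous_snd.sub
      ((Grassmannian.continuous_proj.comp continuous_fst).clm_apply continuous_snd))
  have he : (fun q : Grassmannian n k × Space n => ((mk q.1 q.2).dir, (mk q.1 q.2).foot)) =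
      fun q => (q.1, q.2 - q.1.proj q.2) := by
    ext1 q
    rw [dir_mk, foot_mk]
  change MeasurableSet
    ((fun q : Grassmannian n k × Space n => ((mk q.1 q.2).dir, (mk q.1 q.2).foot)) ⁻¹' t)
  rw [he]
  exact (ht.preimage hc).measurableSet

/-- Lebesgue measure of the fibre `{x ∈ E^⊥ : x + E ∈ A}` depends measurably on `E`. -/
lemma measurable_volume_fibre {A : Set (AffineGrassmannian n k)} (hA : MeasurableSet A) :
    Measurable fun E : Grassmannian n k => volume {x : E.1ᗮ | mk E (x : Space n) ∈ A} := by
  have : SecondCountableTopology (Grassmannian n k) :=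
    TopologicalSpace.secondCountableTopology_induced _ _ Grassmannian.proj
  set c : ℝ≥0∞ := volume (Metric.closedBall (0 : EuclideanSpace ℝ (Fin k)) 1) with hc
  have hc0 : c ≠ 0 := (Metric.measure_closedBall_pos _ _ one_pos).ne'
  have hct : c ≠ ⊤ := measure_closedBall_lt_top.ne
  have hS : MeasurableSet {q : Grassmannian n k × Space n | ‖q.1.proj q.2‖ ≤ 1 ∧ mk q.1 q.2 ∈ A} :=
    (measurableSet_le
      ((Grassmannian.continuous_proj.comp continuous_fst).clm_apply
        continuous_snd).norm.measurable measurable_const).inter (measurable_mk hA)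
  have hm := measurable_measure_prodMk_left (ν := (volume : Measure (Space n))) hS
  have key : ∀ E : Grassmannian n k,
      volume {x : E.1ᗮ | mk E (x : Space n) ∈ A} = c⁻¹ * volume (Prod.mk E ⁻¹'
        {q : Grassmannian n k × Space n | ‖q.1.proj q.2‖ ≤ 1 ∧ mk q.1 q.2 ∈ A}) := by
    intro E
    have hb : volume (Metric.closedBall (0 : E.1) 1) = c := by
      let b := (stdOrthonormalBasis ℝ E.1).reindex (finCongr E.2)
      have := b.measurePreserving_repr.measure_preimage
        (s := Metric.closedBall (0 : EuclideanSpace ℝ (Fin k)) 1)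
        Metric.isClosed_closedBall.measurableSet.nullMeasurableSet
      rw [hc, ← this]
      congr 1
      ext x
      simp
    have hp := (E.1.measurePreserving_measurableEquivProd (0 : Space n)).measure_preimage_equiv
      (Metric.closedBall (0 : E.1) 1 ×ˢ {x : E.1ᗮ | mk E (x : Space n) ∈ A})
    rw [Measure.volume_eq_prod, Measure.prod_prod, hb,
      InnerProductSpace.euclideanHausdorffMeasure_eq_volume] at hp
    rw [← ENNReal.mul_right_inj hc0 hct, ← hp, ← mul_assoc, ENNReal.mul_inv_cancel hc0 hct, one_mul]
    congr 1
    ext z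
    have hz : mk E (z - E.1.starProjection z) = mk E z := by
      refine Subtype.ext (AffineSubspace.ext fun y => ?_)
      change y ∈ AffineSubspace.mk' _ _ ↔ y ∈ AffineSubspace.mk' _ _
      simp only [AffineSubspace.mem_mk', vsub_eq_sub]
      rw [show y - (z - E.1.starProjection z) = (y - z) + E.1.starProjection z by abel]
      exact E.1.add_mem_iff_left (E.1.starProjection_apply_mem z)
    simp [hz, Grassmannian.proj]
  simp_rw [key]
  exact hm.const_mul _

lemma measurable_kernel : Measurable fun E : Grassmannian n k =>
    (volume : Measure E.1ᗮ).map fun x : E.1ᗮ => mk E (x : Space n) := by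
  refine Measure.measurable_of_measurable_coe _ fun A hA => ?_
  convert measurable_volume_fibre hA using 2 with E
  exact Measure.map_apply (measurable_mk.comp
    (measurable_const.prodMk measurable_subtype_coe)) hA

lemma measure_apply (h : k ≤ n) {A : Set (AffineGrassmannian n k)} (hA : MeasurableSet A) :
    measure h A =
      ∫⁻ E, volume {x : E.1ᗮ | mk E (x : Space n) ∈ A} ∂(Grassmannian.haar h) := by
  rw [measure, Measure.bind_apply hA measurable_kernel.aemeasurable]
  refine lintegral_congr fun E => ?_
  exact Measure.map_apply (measurable_mk.comp
    (measurable_const.prodMk measurable_subtype_coe)) hA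

end AffineGrassmannian

/-! ### The functional -/

/-- The norm `‖f|_F‖_p = (∫_F |f|^p)^{1/p} ∈ [0, ∞]` with respect to `k`-dimensional Lebesgue
measure on the affine subspace `F`. -/
def planeNorm {n k : ℕ} {𝕜 : Type*} [RCLike 𝕜] (f : Space n → 𝕜) (p : ℝ)
    (F : AffineGrassmannian n k) : ℝ≥0∞ :=
  eLpNorm' ((F.1 : Set (Space n)).domRestrict f) p (Measure.euclideanHausdorffMeasure k)

/-- The functional `∫_{M_{n,k}} ∏ᵢ ‖fᵢ|_F‖_{pᵢ}^{αᵢ} dν_{n,k}(F)`, with the conventions of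
`[0, ∞]`: `0 ^ a = ∞` and `∞ ^ a = 0` for `a < 0`, and `0 * ∞ = 0`. -/
def affineFunctional {n k m : ℕ} (h : k ≤ n) {𝕜 : Type*} [RCLike 𝕜] (p α : Fin m → ℝ)
    (f : Fin m → Space n → 𝕜) : ℝ≥0∞ :=
  ∫⁻ F, ∏ i, planeNorm (f i) (p i) F ^ α i ∂(AffineGrassmannian.measure h)

end AffineGrass

end

/-!
Additive Haar measure on the linear maps `X : ℝᵏ → ℝⁿ` splits into a measure on the orbits
`{X ∘L T}`, `T` an endomorphism of `ℝᵏ`, and the density `|det T| ^ (n - k)` along each orbit. An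
orbit is determined by the range of `X`, so the Haar probability on the Grassmannian is, up to a
constant, the law of the range of `X` for `X` in the unit ball, and a linear map `A` with
`|det A| = 1` preserves Haar measure while it turns the unit ball into an ellipsoid. Along the orbit
of maps onto `E`, the ball and the ellipsoid differ by the factor `J ^ (-n)`, where `J` is the
factor by which `A` scales the volume of `E`: this is the density with which `A` transports
`μ_{n,k}`. Lebesgue measure on `Eᗮ` contributes a further `J⁻¹`, since volumes in `E` and in the
quotient by `E` scale inversely, so a volume-preserving affine map transports `ν_{n,k}` with density
`J ^ (-(n + 1))`. As `∫_F |f| ^ p` scales by `J`, the product of the norms scales by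
`J ^ ∑ α_i / p_i = J ^ (n + 1)`, which cancels the density.
-/

noncomputable section

namespace AffineGrass

/-! ### Haar measure on spaces of linear maps -/

section HomSpace

variable {U V : Type*} [NormedAddCommGroup U] [NormedSpace ℝ U]
  [NormedAddCommGroup V] [NormedSpace ℝ V]

/-- The integral of `w` over the orbit `{X ∘L T}` of `X` under invertible `T`, against the density
`|det T| ^ (dim V - dim U)` with which these orbits enter the additive Haar measure of
`U →L[ℝ] V`. -/
def orbitIntegral (ν : Measure (U →L[ℝ] U)) (w : (U →L[ℝ] V) → ℝ≥0∞) (X : U →L[ℝ] V) : ℝ≥0∞ :=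
  ∫⁻ T, ENNReal.ofReal (|T.det| ^ (Module.finrank ℝ V - Module.finrank ℝ U)) * w (X ∘L T) ∂ν

lemma measurable_abs_det_pow (d : ℕ) :
    Measurable fun T : U →L[ℝ] U => ENNReal.ofReal (|T.det| ^ d) :=
  (ContinuousLinearMap.continuous_det.abs.pow d).measurable.ennreal_ofReal

variable [FiniteDimensional ℝ U]

lemma measurable_orbitIntegral (ν : Measure (U →L[ℝ] U)) [SFinite ν]
    {w : (U →L[ℝ] V) → ℝ≥0∞} (hw : Measurable w) : Measurable (orbitIntegral ν w) :=
  Measurable.lintegral_prod_right' (f := fun q : (U →L[ℝ] V) × (U →L[ℝ] U) =>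
    ENNReal.ofReal (|q.2.det| ^ (Module.finrank ℝ V - Module.finrank ℝ U)) * w (q.1 ∘L q.2))
    (((measurable_abs_det_pow _).comp measurable_snd).mul
      (hw.comp (continuous_fst.clm_comp continuous_snd).measurable))

-- A line through an endomorphism in the direction of the identity meets `det = 0` in finitely
-- many points, the negatives of its eigenvalues.
lemma ae_det_ne_zero (ν : Measure (U →L[ℝ] U)) [ν.IsAddHaarMeasure] : ∀ᵐ T ∂ν, T.det ≠ 0 := by
  refine ae_mem_of_ae_add_linearMap_mem (s := {T : U →L[ℝ] U | T.det ≠ 0})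
    (LinearMap.toSpanSingleton ℝ (U →L[ℝ] U) 1) volume ν
    (isOpen_ne_fun ContinuousLinearMap.continuous_det continuous_const).measurableSet fun S => ?_
  have hfin : {t : ℝ | (-S).toLinearMap.charpoly.IsRoot t}.Finite :=
    Polynomial.finite_setOfPred_isRoot (LinearMap.charpoly_monic _).ne_zero
  filter_upwards [hfin.countable.ae_notMem volume] with t ht hdet
  refine ht ?_
  rw [Polynomial.IsRoot, LinearMap.eval_charpoly, ← hdet, ContinuousLinearMap.det]
  congr 1
  ext x
  simp [add_comm]

lemma mul_orbitIntegral (ν : Measure (U →L[ℝ] U)) [ν.IsAddHaarMeasure]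
    {Ψ w : (U →L[ℝ] V) → ℝ≥0∞} (hw : Measurable w) {X : U →L[ℝ] V}
    (hinv : ∀ T : U →L[ℝ] U, T.det ≠ 0 → Ψ (X ∘L T) = Ψ X) :
    Ψ X * orbitIntegral ν w X = orbitIntegral ν (fun Y => Ψ Y * w Y) X := by
  have hwX : Measurable fun T : U →L[ℝ] U => ENNReal.ofReal
      (|T.det| ^ (Module.finrank ℝ V - Module.finrank ℝ U)) * w (X ∘L T) :=
    (measurable_abs_det_pow _).mul (hw.comp (continuous_const.clm_comp continuous_id).measurable)
  rw [orbitIntegral, ← lintegral_const_mul _ hwX]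
  refine lintegral_congr_ae ?_
  filter_upwards [ae_det_ne_zero ν] with T hT
  rw [hinv T hT, mul_left_comm]

variable [FiniteDimensional ℝ V]

lemma det_postcomp (A : V →L[ℝ] V) :
    (A.postcomp U : (U →L[ℝ] V) →L[ℝ] U →L[ℝ] V).det = A.det ^ Module.finrank ℝ U := by
  let b := Module.finBasis ℝ U
  let e : (U →L[ℝ] V) ≃ₗ[ℝ] (Fin (Module.finrank ℝ U) → V) :=
    LinearMap.toContinuousLinearMap.symm.trans (b.constr ℝ).symm
  have he (X : U →L[ℝ] V) (i) : e X i = X (b i) := rfl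
  have hconj : e.toLinearMap ∘ₗ
      (A.postcomp U : (U →L[ℝ] V) →L[ℝ] U →L[ℝ] V).toLinearMap ∘ₗ e.symm =
      LinearMap.pi fun i => A.toLinearMap ∘ₗ LinearMap.proj i := by
    refine LinearMap.ext fun v => funext fun i => congrArg A ?_
    exact (he _ i).symm.trans (congrFun (e.apply_symm_apply v) i)
  rw [ContinuousLinearMap.det, ← LinearMap.det_conj _ e, hconj, LinearMap.det_pi]
  simp [ContinuousLinearMap.det]

lemma det_precomp (T : U →L[ℝ] U) :
    (T.precomp V : (U →L[ℝ] V) →L[ℝ] U →L[ℝ] V).det = T.det ^ Module.finrank ℝ V := by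
  let b := (Module.finBasis ℝ V).equivFun
  let e : (U →L[ℝ] V) ≃ₗ[ℝ] (Fin (Module.finrank ℝ V) → Module.Dual ℝ U) :=
    { toFun := fun X i => LinearMap.proj i ∘ₗ b.toLinearMap ∘ₗ X.toLinearMap
      map_add' := fun X Y => by ext; simp
      map_smul' := fun c X => by ext; simp
      invFun := fun φ => LinearMap.toContinuousLinearMap (b.symm.toLinearMap ∘ₗ LinearMap.pi φ)
      left_inv := fun X => by ext; simp
      right_inv := fun φ => by ext; simp }
  have hconj : e.toLinearMap ∘ₗ
      (T.precomp V : (U →L[ℝ] V) →L[ℝ] U →L[ℝ] V).toLinearMap ∘ₗ e.symm =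
      LinearMap.pi fun i => T.toLinearMap.dualMap ∘ₗ LinearMap.proj i :=
    LinearMap.ext fun φ => funext fun i => LinearMap.ext fun y =>
      DFunLike.congr_fun (congrFun (e.apply_symm_apply φ) i) (T y)
  rw [ContinuousLinearMap.det, ← LinearMap.det_conj _ e, hconj, LinearMap.det_pi]
  simp [ContinuousLinearMap.det, LinearMap.det_dualMap]

lemma lintegral_eq_abs_det_mul_lintegral_comp [MeasurableSpace V] [BorelSpace V] (μ : Measure V)
    [μ.IsAddHaarMeasure] {L : V →L[ℝ] V} (hL : L.det ≠ 0) {f : V → ℝ≥0∞} (hf : Measurable f) :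
    ∫⁻ x, f x ∂μ = ENNReal.ofReal |L.det| * ∫⁻ x, f (L x) ∂μ := by
  rw [← lintegral_map hf L.continuous.measurable,
    ← ContinuousLinearMap.coe_coe, Measure.map_linearMap_addHaar_eq_smul_addHaar μ hL,
    lintegral_smul_measure, smul_eq_mul, ← mul_assoc, ← ENNReal.ofReal_mul (abs_nonneg _),
    ← abs_mul]
  simp [mul_inv_cancel₀ (show LinearMap.det L.toLinearMap ≠ 0 from hL), ContinuousLinearMap.det]

lemma lintegral_eq_abs_det_pow_mul_lintegral_comp_left (μ : Measure (U →L[ℝ] V))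
    [μ.IsAddHaarMeasure] {A : V →L[ℝ] V} (hA : A.det ≠ 0) {f : (U →L[ℝ] V) → ℝ≥0∞}
    (hf : Measurable f) :
    ∫⁻ X, f X ∂μ = ENNReal.ofReal (|A.det| ^ Module.finrank ℝ U) * ∫⁻ X, f (A ∘L X) ∂μ := by
  rw [lintegral_eq_abs_det_mul_lintegral_comp μ (L := A.postcomp U)
    (by rw [det_postcomp]; exact pow_ne_zero _ hA) hf, det_postcomp, abs_pow]
  rfl

lemma lintegral_eq_abs_det_pow_mul_lintegral_comp_right (μ : Measure (U →L[ℝ] V))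
    [μ.IsAddHaarMeasure] {T : U →L[ℝ] U} (hT : T.det ≠ 0) {f : (U →L[ℝ] V) → ℝ≥0∞}
    (hf : Measurable f) :
    ∫⁻ X, f X ∂μ = ENNReal.ofReal (|T.det| ^ Module.finrank ℝ V) * ∫⁻ X, f (X ∘L T) ∂μ := by
  rw [lintegral_eq_abs_det_mul_lintegral_comp μ (L := T.precomp V)
    (by rw [det_precomp]; exact pow_ne_zero _ hT) hf, det_precomp, abs_pow]
  rfl

-- Substitute `Z = Y ∘L T` at fixed `T`.
lemma lintegral_prod_eq_lintegral_lintegral_comp (ν : Measure (U →L[ℝ] U)) [ν.IsAddHaarMeasure]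
    (μ : Measure (U →L[ℝ] V)) [μ.IsAddHaarMeasure]
    {F : (U →L[ℝ] U) × (U →L[ℝ] V) → ℝ≥0∞} (hF : Measurable F) :
    ∫⁻ q, F q ∂(ν.prod μ) =
      ∫⁻ Y, ∫⁻ T, ENNReal.ofReal (|T.det| ^ Module.finrank ℝ V) * F (T, Y ∘L T) ∂ν ∂μ := by
  have hcomp : Continuous fun q : (U →L[ℝ] U) × (U →L[ℝ] V) => (q.1, q.2 ∘L q.1) :=
    continuous_fst.prodMk (continuous_snd.clm_comp continuous_fst)
  have hint : Measurable fun q : (U →L[ℝ] U) × (U →L[ℝ] V) =>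
      ENNReal.ofReal (|q.1.det| ^ Module.finrank ℝ V) * F (q.1, q.2 ∘L q.1) :=
    ((measurable_abs_det_pow _).comp measurable_fst).mul (hF.comp hcomp.measurable)
  rw [lintegral_prod _ hF.aemeasurable, ← lintegral_lintegral_swap
    (f := fun T Y => ENNReal.ofReal (|T.det| ^ Module.finrank ℝ V) * F (T, Y ∘L T))
    hint.aemeasurable]
  refine lintegral_congr_ae ?_
  filter_upwards [ae_det_ne_zero ν] with T hT
  have hFT : Measurable fun Z => F (T, Z) := hF.comp measurable_prodMk_left
  rw [lintegral_const_mul' _ _ ENNReal.ofReal_ne_top]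
  exact lintegral_eq_abs_det_pow_mul_lintegral_comp_right μ hT hFT

-- Almost every `X` is `X₀ ∘L T` with `X₀` the graph of a map into a fixed complement, and `ρ` is
-- the Lebesgue measure on such graphs.
theorem exists_lintegral_mul_eq_lintegral_mul_orbitIntegral
    (h : Module.finrank ℝ U ≤ Module.finrank ℝ V)
    (μ : Measure (U →L[ℝ] V)) [μ.IsAddHaarMeasure]
    (ν : Measure (U →L[ℝ] U)) [ν.IsAddHaarMeasure] :
    ∃ ρ : Measure (U →L[ℝ] V), (∀ᵐ X : U →L[ℝ] V ∂ρ, Function.Injective X) ∧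
      ∀ Ψ w : (U →L[ℝ] V) → ℝ≥0∞, Measurable Ψ → Measurable w →
        (∀ (X : U →L[ℝ] V) (T : U →L[ℝ] U), T.det ≠ 0 → Ψ (X ∘L T) = Ψ X) →
        ∫⁻ X, Ψ X * w X ∂μ = ∫⁻ X, Ψ X * orbitIntegral ν w X ∂ρ := by
  let W := EuclideanSpace ℝ (Fin (Module.finrank ℝ V - Module.finrank ℝ U))
  let e : (U × W) ≃L[ℝ] V := ContinuousLinearEquiv.ofFinrankEq (by simp [W, h])
  let lam : Measure (U →L[ℝ] W) := Measure.addHaar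
  let Φ : ((U →L[ℝ] U) × (U →L[ℝ] W)) ≃L[ℝ] (U →L[ℝ] V) :=
    (ContinuousLinearMap.prodL ℝ).trans ((ContinuousLinearEquiv.refl ℝ U).arrowCongr e)
  have hΦ_comp (T : U →L[ℝ] U) (Y : U →L[ℝ] W) : Φ (T, Y ∘L T) = Φ (1, Y) ∘L T := rfl
  have hΦ_inj (Y : U →L[ℝ] W) : Function.Injective (Φ (1, Y)) := fun x y hxy =>
    congrArg Prod.fst (e.injective hxy)
  have hgraph : Measurable fun Y : U →L[ℝ] W => Φ (1, Y) :=
    (Φ.continuous.comp (Continuous.prodMk_right 1)).measurable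
  have : ((ν.prod lam).map Φ).IsAddHaarMeasure := Φ.isAddHaarMeasure_map _
  set c := μ.addHaarScalarFactor ((ν.prod lam).map Φ)
  have hμ : μ = c • (ν.prod lam).map Φ := Measure.isAddLeftInvariant_eq_smul _ _
  refine ⟨c • lam.map fun Y => Φ (1, Y), Measure.ae_smul_measure ?_ c, fun Ψ w hΨ hw hinv => ?_⟩
  · exact (ae_map_iff hgraph.aemeasurable
      ContinuousLinearMap.isOpen_injective.measurableSet).2 (ae_of_all _ hΦ_inj)
  have hΨw : Measurable fun X => Ψ X * w X := hΨ.mul hw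
  have hΨorbit : Measurable fun X => Ψ X * orbitIntegral ν w X :=
    hΨ.mul (measurable_orbitIntegral ν hw)
  rw [hμ, lintegral_smul_measure, lintegral_smul_measure,
    lintegral_map hΨw Φ.continuous.measurable, lintegral_map hΨorbit hgraph,
    lintegral_prod_eq_lintegral_lintegral_comp ν lam (F := fun q => Ψ (Φ q) * w (Φ q))
      (hΨw.comp Φ.continuous.measurable)]
  refine congrArg (c • ·) (lintegral_congr fun Y => ?_)
  rw [mul_orbitIntegral ν hw (hinv _)]
  simp only [hΦ_comp, orbitIntegral, W, finrank_euclideanSpace_fin]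

lemma ae_injective (h : Module.finrank ℝ U ≤ Module.finrank ℝ V) (μ : Measure (U →L[ℝ] V))
    [μ.IsAddHaarMeasure] : ∀ᵐ X : U →L[ℝ] V ∂μ, Function.Injective X := by
  obtain ⟨ρ, hρ_inj, hρ⟩ := exists_lintegral_mul_eq_lintegral_mul_orbitIntegral h μ Measure.addHaar
  have hmeas : MeasurableSet {X : U →L[ℝ] V | Function.Injective X}ᶜ :=
    ContinuousLinearMap.isOpen_injective.measurableSet.compl
  have hinv (X : U →L[ℝ] V) (T : U →L[ℝ] U) (hT : T.det ≠ 0) :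
      ({X : U →L[ℝ] V | Function.Injective X}ᶜ).indicator (1 : (U →L[ℝ] V) → ℝ≥0∞) (X ∘L T) =
        ({X : U →L[ℝ] V | Function.Injective X}ᶜ).indicator 1 X := by
    have hXT : Function.Injective (X ∘L T) ↔ Function.Injective X :=
      Function.Injective.of_comp_iff' X (T.toContinuousLinearEquivOfDetNeZero hT).bijective
    classical
    simp only [Set.indicator_apply, mem_compl_iff, mem_ofPred_eq, hXT, Pi.one_apply]
  have hzero := hρ _ 1 (measurable_one.indicator hmeas) measurable_one hinv
  simp only [Pi.one_apply, mul_one, lintegral_indicator_one hmeas] at hzero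
  refine hzero.trans ((lintegral_congr_ae ?_).trans lintegral_zero)
  filter_upwards [hρ_inj] with X hX
  rw [Set.indicator_of_notMem (notMem_compl_iff.2 hX), zero_mul]

end HomSpace

section InnerProductSpace

variable {U V : Type*} [NormedAddCommGroup U] [InnerProductSpace ℝ U] [FiniteDimensional ℝ U]
  [NormedAddCommGroup V] [InnerProductSpace ℝ V]

lemma exists_linearIsometry_range_eq {E : Submodule ℝ V} [FiniteDimensional ℝ E]
    (hE : Module.finrank ℝ U = Module.finrank ℝ E) :
    ∃ Q : U →ₗᵢ[ℝ] V, LinearMap.range Q.toLinearMap = E := by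
  let e : U ≃ₗᵢ[ℝ] E :=
    (stdOrthonormalBasis ℝ U).equiv (stdOrthonormalBasis ℝ E) (finCongr hE)
  refine ⟨E.subtypeₗᵢ.comp e.toLinearIsometry, ?_⟩
  change LinearMap.range (E.subtype ∘ₗ e.toLinearEquiv.toLinearMap) = E
  rw [LinearMap.range_comp, LinearEquiv.range, Submodule.map_top, Submodule.range_subtype]

lemma exists_linearIsometry_comp_eq {X : U →L[ℝ] V} (hX : Function.Injective X) :
    ∃ (Q : U →ₗᵢ[ℝ] V) (S : U →L[ℝ] U), X = Q.toContinuousLinearMap ∘L S := by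
  obtain ⟨Q, hQ⟩ := exists_linearIsometry_range_eq (U := U) (E := X.range)
    (LinearMap.finrank_range_of_inj hX).symm
  have hmem (x : U) : ∃ y, Q y = X x := (SetLike.ext_iff.1 hQ (X x)).2 ⟨x, rfl⟩
  choose S hS using hmem
  refine ⟨Q, LinearMap.toContinuousLinearMap
    { toFun := S, map_add' := fun x y => ?_, map_smul' := fun c x => ?_ }, ?_⟩
  · exact Q.injective (by simp [hS])
  · exact Q.injective (by simp [hS])
  · ext x
    exact (hS x).symm

lemma normDet_isometry_comp (Q : U →ₗᵢ[ℝ] V) (S : U →L[ℝ] U) :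
    (Q.toContinuousLinearMap ∘L S).toLinearMap.normDet = |S.det| := by
  have h := LinearMap.normDet_comp_of_finrank_eq S.toLinearMap Q.toLinearMap rfl
  rwa [Q.normDet_eq_one, one_mul, LinearMap.normDet_eq_abs_det] at h

lemma normDet_pos {X : U →L[ℝ] V} (hX : Function.Injective X) : 0 < X.toLinearMap.normDet :=
  X.toLinearMap.normDet_nonneg.lt_of_ne' fun h =>
    LinearMap.normDet_eq_zero_iff_ker_ne_bot.1 h (LinearMap.ker_eq_bot.2 hX)

variable [FiniteDimensional ℝ V]

lemma continuous_normDet : Continuous fun X : U →L[ℝ] V => X.toLinearMap.normDet := by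
  have h : (fun X : U →L[ℝ] V => X.toLinearMap.normDet) = fun X =>
      √(ContinuousLinearMap.adjoint X ∘L X).det := by
    ext X
    rw [← Real.sqrt_sq X.toLinearMap.normDet_nonneg]
    exact congrArg _ X.normDet_sq
  rw [h]
  exact (ContinuousLinearMap.continuous_det.comp
    (ContinuousLinearMap.adjoint.continuous.clm_comp continuous_id)).sqrt

-- Write `X = Q ∘L S` with `Q` isometric and substitute `T ↦ S ∘L T`.
lemma orbitIntegral_closedBall (ν : Measure (U →L[ℝ] U)) [ν.IsAddHaarMeasure] {X : U →L[ℝ] V}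
    (hX : Function.Injective X) :
    orbitIntegral ν ((Metric.closedBall 0 1).indicator 1) X =
      (ENNReal.ofReal (X.toLinearMap.normDet ^ Module.finrank ℝ V))⁻¹ *
        ∫⁻ T, ENNReal.ofReal (|T.det| ^ (Module.finrank ℝ V - Module.finrank ℝ U)) *
          (Metric.closedBall 0 1).indicator 1 T ∂ν := by
  have hdim : Module.finrank ℝ U ≤ Module.finrank ℝ V :=
    LinearMap.finrank_le_finrank_of_injective (f := X.toLinearMap) hX
  have hpos := normDet_pos hX
  obtain ⟨Q, S, rfl⟩ := exists_linearIsometry_comp_eq hX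
  rw [normDet_isometry_comp] at hpos ⊢
  set d := Module.finrank ℝ V - Module.finrank ℝ U with hd
  have hball (T : U →L[ℝ] U) :
      (Metric.closedBall 0 1).indicator (1 : (U →L[ℝ] V) → ℝ≥0∞)
        ((Q.toContinuousLinearMap ∘L S) ∘L T) =
      (Metric.closedBall 0 1).indicator 1 (S ∘L T) := by
    classical
    simp only [ContinuousLinearMap.comp_assoc, Set.indicator_apply, mem_closedBall_zero_iff,
      Q.norm_toContinuousLinearMap_comp, Pi.one_apply]
  have hmeas : Measurable fun T : U →L[ℝ] U =>
      ENNReal.ofReal (|T.det| ^ d) * (Metric.closedBall 0 1).indicator 1 T :=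
    (measurable_abs_det_pow d).mul (measurable_one.indicator measurableSet_closedBall)
  have hdet (T : U →L[ℝ] U) : ENNReal.ofReal (|(S ∘L T).det| ^ d) =
      ENNReal.ofReal (|S.det| ^ d) * ENNReal.ofReal (|T.det| ^ d) := by
    rw [← ENNReal.ofReal_mul (by positivity), ← mul_pow, ← abs_mul]
    exact congrArg (fun t => ENNReal.ofReal (|t| ^ d)) (LinearMap.det_comp _ _)
  have hpow : |S.det| ^ Module.finrank ℝ U * |S.det| ^ d = |S.det| ^ Module.finrank ℝ V := by
    rw [← pow_add, hd, Nat.add_sub_cancel' hdim]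
  rw [lintegral_eq_abs_det_pow_mul_lintegral_comp_left ν (abs_pos.1 hpos) hmeas]
  simp_rw [orbitIntegral, hball, hdet, mul_assoc]
  rw [lintegral_const_mul' _ _ ENNReal.ofReal_ne_top, ← mul_assoc (ENNReal.ofReal _),
    ← ENNReal.ofReal_mul (by positivity), hpow, ENNReal.inv_mul_cancel_left
    (ENNReal.ofReal_pos.2 (by positivity)).ne' ENNReal.ofReal_ne_top]

end InnerProductSpace

/-! ### Linear maps acting on the Grassmannian -/

section OrthGroup

variable {n : ℕ}

lemma exists_orthAct_eq (e : Space n ≃ₗᵢ[ℝ] Space n) : ∃ U, orthAct U = e := by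
  let Θ := Matrix.toEuclideanCLM (n := Fin n) (𝕜 := ℝ)
  let u := Unitary.linearIsometryEquiv.symm e
  refine ⟨⟨Θ.symm u.1, Unitary.map_mem Θ.symm u.2⟩, LinearIsometryEquiv.ext fun x => ?_⟩
  exact congrArg (fun f : Space n →L[ℝ] Space n => f x) (Θ.apply_symm_apply u.1)

lemma continuous_toEuclideanCLM : Continuous fun U : OrthGroup n =>
    Matrix.toEuclideanCLM (n := Fin n) (𝕜 := ℝ) U.1 := by
  have hlin : Continuous (Matrix.toEuclideanCLM (n := Fin n) (𝕜 := ℝ)) :=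
    LinearMap.continuous_of_finiteDimensional
      (Matrix.toEuclideanCLM (n := Fin n) (𝕜 := ℝ)).toAlgEquiv.toLinearMap
  exact hlin.comp continuous_subtype_val

end OrthGroup

/-- Linear maps `ℝᵏ → ℝⁿ`; the injective ones parametrise the Grassmannian by their range. -/
abbrev Hom (k n : ℕ) : Type := Space k →L[ℝ] Space n

namespace Grassmannian

variable {k n : ℕ}

instance : SecondCountableTopology (Grassmannian n k) :=
  TopologicalSpace.secondCountableTopology_induced _ _ proj

lemma injective_proj : Function.Injective (proj : Grassmannian n k → _) := by
  intro E E' hEE'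
  refine Subtype.ext ?_
  rw [← Submodule.range_starProjection E.1, ← Submodule.range_starProjection E'.1]
  exact congrArg (fun f : Space n →L[ℝ] Space n => LinearMap.range f.toLinearMap) hEE'

instance : T2Space (Grassmannian n k) :=
  T2Space.of_injective_continuous injective_proj continuous_proj

/-- The image of a subspace under an invertible linear map. -/
def map (A : Space n ≃L[ℝ] Space n) (E : Grassmannian n k) : Grassmannian n k :=
  ⟨E.1.map A.toLinearEquiv.toLinearMap, by rw [LinearEquiv.finrank_map_eq]; exact E.2⟩

/-- The factor by which `A` scales the `k`-dimensional volume of `E`. -/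
def jac (A : Space n ≃L[ℝ] Space n) (E : Grassmannian n k) : ℝ :=
  (A.toLinearEquiv.toLinearMap.domRestrict E.1).normDet

lemma jac_pos (A : Space n ≃L[ℝ] Space n) (E : Grassmannian n k) : 0 < jac A E :=
  normDet_pos (X := (A : Space n →L[ℝ] Space n) ∘L E.1.subtypeL)
    (A.injective.comp Subtype.val_injective)

/-- The range of an injective linear map `ℝᵏ → ℝⁿ`. -/
def ofInjective (X : Hom k n) (hX : Function.Injective X) : Grassmannian n k :=
  ⟨LinearMap.range X.toLinearMap, by rw [LinearMap.finrank_range_of_inj hX]; simp⟩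

open Classical in
/-- The range of `X` if it has dimension `k`, and `ℝ e₁ ⊕ ⋯ ⊕ ℝ e_k` otherwise. -/
def span (h : k ≤ n) (X : Hom k n) : Grassmannian n k :=
  if hX : Function.Injective X then ofInjective X hX else coord h

variable (h : k ≤ n)

lemma span_of_injective {X : Hom k n} (hX : Function.Injective X) :
    span h X = ofInjective X hX :=
  dif_pos hX

lemma span_of_not_injective {X : Hom k n} (hX : ¬ Function.Injective X) : span h X = coord h :=
  dif_neg hX

lemma coe_span {X : Hom k n} (hX : Function.Injective X) :
    (span h X).1 = LinearMap.range X.toLinearMap :=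
  congrArg Subtype.val (span_of_injective h hX)

lemma span_comp_right (X : Hom k n) {T : Hom k k} (hT : T.det ≠ 0) :
    span h (X ∘L T) = span h X := by
  have hT' : Function.Bijective T := (T.toContinuousLinearEquivOfDetNeZero hT).bijective
  by_cases hX : Function.Injective X
  · refine Subtype.ext ?_
    rw [coe_span h hX, coe_span h (X := X ∘L T) (hX.comp hT'.injective)]
    exact LinearMap.range_comp_of_range_eq_top _ (LinearMap.range_eq_top.2 hT'.surjective)
  · have hXT : ¬ Function.Injective (X ∘L T) := fun hXT =>
      hX ((Function.Injective.of_comp_iff' X hT').1 hXT)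
    rw [span_of_not_injective h hX, span_of_not_injective h hXT]

lemma span_comp_left {X : Hom k n} (hX : Function.Injective X) (A : Space n ≃L[ℝ] Space n) :
    span h ((A : Hom n n) ∘L X) = map A (span h X) := by
  rw [span_of_injective h hX, span_of_injective h (X := (A : Hom n n) ∘L X) (A.injective.comp hX)]
  exact Subtype.ext (LinearMap.range_comp _ _)

lemma normDet_comp_left {X : Hom k n} (hX : Function.Injective X) (A : Space n ≃L[ℝ] Space n) :
    ((A : Hom n n) ∘L X).toLinearMap.normDet = jac A (span h X) * X.toLinearMap.normDet := by
  rw [span_of_injective h hX]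
  exact LinearMap.normDet_comp X.toLinearMap A.toLinearEquiv.toLinearMap

lemma exists_linearIsometry_span_eq (E : Grassmannian n k) :
    ∃ Q : Space k →ₗᵢ[ℝ] Space n, span h Q.toContinuousLinearMap = E := by
  obtain ⟨Q, hQ⟩ := exists_linearIsometry_range_eq (U := Space k) (E := E.1) (by simp [E.2])
  exact ⟨Q, Subtype.ext ((coe_span h Q.injective).trans hQ)⟩

lemma isUnit_adjoint_comp {X : Hom k n} (hX : Function.Injective X) :
    IsUnit (X.adjoint ∘L X) := by
  have hinj : Function.Injective (X.adjoint ∘L X) :=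
    (injective_iff_map_eq_zero _).2 fun x hx => by
      refine (map_eq_zero_iff X hX).1 ((inner_self_eq_zero (𝕜 := ℝ)).1 ?_)
      rw [← ContinuousLinearMap.adjoint_inner_right]
      exact (congrArg (inner ℝ x) hx).trans (inner_zero_right x)
  exact ContinuousLinearMap.isUnit_iff_bijective.2
    ⟨hinj, LinearMap.surjective_of_injective (f := (X.adjoint ∘L X).toLinearMap) hinj⟩

lemma proj_span {X : Hom k n} (hX : Function.Injective X) :
    proj (span h X) = X ∘L Ring.inverse (X.adjoint ∘L X) ∘L X.adjoint := by
  ext1 x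
  refine Submodule.eq_starProjection_of_mem_of_inner_eq_zero ?_ ?_
  · rw [coe_span h hX]
    exact ⟨_, rfl⟩
  · intro w hw
    rw [coe_span h hX] at hw
    obtain ⟨y, rfl⟩ := hw
    have hcancel : X.adjoint (X (Ring.inverse (X.adjoint ∘L X) (X.adjoint x))) = X.adjoint x :=
      DFunLike.congr_fun (Ring.mul_inverse_cancel _ (isUnit_adjoint_comp hX)) (X.adjoint x)
    refine (ContinuousLinearMap.adjoint_inner_left X y _).symm.trans ?_
    simp only [map_sub, ContinuousLinearMap.comp_apply, hcancel, sub_self, inner_zero_left]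

lemma continuousOn_span : ContinuousOn (span h) {X : Hom k n | Function.Injective X} := by
  rw [continuousOn_iff_continuous_domRestrict, continuous_induced_rng]
  have hproj : proj ∘ {X : Hom k n | Function.Injective X}.domRestrict (span h) =
      fun X => X.1 ∘L Ring.inverse (X.1.adjoint ∘L X.1) ∘L X.1.adjoint :=
    funext fun X => proj_span h X.2
  have hadj : Continuous fun X : {X : Hom k n | Function.Injective X} => X.1.adjoint :=
    ContinuousLinearMap.adjoint.continuous.comp continuous_subtype_val
  rw [hproj]
  refine continuous_subtype_val.clm_comp (Continuous.clm_comp ?_ hadj)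
  refine continuous_iff_continuousAt.2 fun X => ?_
  obtain ⟨u, hu⟩ := isUnit_adjoint_comp X.2
  refine ContinuousAt.comp (g := Ring.inverse) ?_
    (hadj.clm_comp continuous_subtype_val).continuousAt
  rw [← hu]
  exact NormedRing.inverse_continuousAt u

lemma measurable_span : Measurable (span h : Hom k n → _) := by
  classical
  have hpiecewise : span h =
      {X : Hom k n | Function.Injective X}.piecewise (span h) fun _ => coord h := by
    ext1 X
    by_cases hX : Function.Injective X
    · exact (Set.piecewise_eq_of_mem _ _ _ hX).symm
    · rw [Set.piecewise_eq_of_notMem _ _ _ hX, span_of_not_injective h hX]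
  rw [hpiecewise]
  exact (continuousOn_span h).measurable_piecewise continuousOn_const
    ContinuousLinearMap.isOpen_injective.measurableSet

lemma exists_rotate_eq (E : Grassmannian n k) : ∃ U, rotate U (coord h) = E := by
  let e : (coord h).1 ≃ₗᵢ[ℝ] E.1 := (stdOrthonormalBasis ℝ (coord h).1).equiv
    (stdOrthonormalBasis ℝ E.1) (finCongr ((coord h).2.trans E.2.symm))
  let L : (coord h).1 →ₗᵢ[ℝ] Space n := E.1.subtypeₗᵢ.comp e.toLinearIsometry
  obtain ⟨U, hU⟩ := exists_orthAct_eq (L.extend.toLinearIsometryEquiv rfl)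
  refine ⟨U, Subtype.ext (Submodule.ext fun y => ?_)⟩
  have hrotate (x : (coord h).1) : orthAct U x = e x := by
    rw [hU]
    exact L.extend_apply x
  constructor
  · rintro ⟨x, hx, rfl⟩
    exact (hrotate ⟨x, hx⟩) ▸ (e ⟨x, hx⟩).2
  · intro hy
    refine ⟨e.symm ⟨y, hy⟩, (e.symm ⟨y, hy⟩).2, (hrotate _).trans ?_⟩
    rw [e.apply_symm_apply]

lemma isQuotientMap_rotate : IsQuotientMap fun U => rotate U (coord h) :=
  (continuous_rotate (coord h)).isClosedMap.isQuotientMap (continuous_rotate _)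
    (exists_rotate_eq h)

lemma isQuotientMap_span :
    IsQuotientMap fun X : {X : Hom k n // Function.Injective X} => span h X.1 := by
  obtain ⟨Q, hQ⟩ := exists_linearIsometry_span_eq h (coord h)
  let frame (U : OrthGroup n) : {X : Hom k n // Function.Injective X} :=
    ⟨Matrix.toEuclideanCLM (n := Fin n) (𝕜 := ℝ) U.1 ∘L Q.toContinuousLinearMap,
      (orthAct U).injective.comp Q.injective⟩
  have hframe : Continuous frame :=
    (continuous_toEuclideanCLM.clm_comp continuous_const).subtype_mk _
  refine IsQuotientMap.of_comp hframe (continuousOn_span h).domRestrict ?_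
  convert isQuotientMap_rotate h using 2 with U
  rw [← hQ]
  exact span_comp_left h Q.injective (orthAct U).toContinuousLinearEquiv

lemma continuous_map (h : k ≤ n) (A : Space n ≃L[ℝ] Space n) :
    Continuous (map A : Grassmannian n k → Grassmannian n k) := by
  refine (isQuotientMap_span h).continuous_iff.2 ?_
  have hspan : map A ∘ (fun X : {X : Hom k n // Function.Injective X} => span h X.1) =
      fun X => span h ((A : Hom n n) ∘L X.1) := funext fun X => (span_comp_left h X.2 A).symm
  rw [hspan]
  exact (continuousOn_span h).comp_continuous (continuous_const.clm_comp continuous_subtype_val)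
    fun X => A.injective.comp X.2

lemma continuous_jac (h : k ≤ n) (A : Space n ≃L[ℝ] Space n) :
    Continuous (jac A : Grassmannian n k → ℝ) := by
  refine (isQuotientMap_span h).continuous_iff.2 ?_
  have hspan : jac A ∘ (fun X : {X : Hom k n // Function.Injective X} => span h X.1) = fun X =>
      ((A : Hom n n) ∘L X.1).toLinearMap.normDet / X.1.toLinearMap.normDet :=
    funext fun X => eq_div_of_mul_eq (normDet_pos X.2).ne' (normDet_comp_left h X.2 A).symm
  rw [hspan]
  exact (continuous_normDet.comp (continuous_const.clm_comp continuous_subtype_val)).div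
    (continuous_normDet.comp continuous_subtype_val) fun X => (normDet_pos X.2).ne'

lemma measurable_rotate_inv :
    Measurable fun q : OrthGroup n × Grassmannian n k => rotate q.1⁻¹ q.2 := by
  refine measurable_of_proj ?_
  have hstar (q : OrthGroup n × Grassmannian n k) : star (q.1⁻¹).1 = q.1.1 := star_star _
  simp only [proj_rotate, hstar]
  exact ((continuous_toEuclideanCLM.comp continuous_fst.inv).clm_comp
    ((continuous_proj.comp continuous_snd).clm_comp
      (continuous_toEuclideanCLM.comp continuous_fst))).measurable

lemma lintegral_orthHaar_rotate_inv (Φ : Grassmannian n k → ℝ≥0∞) (E : Grassmannian n k) :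
    ∫⁻ U, Φ (rotate U⁻¹ E) ∂(orthHaar n) = ∫⁻ U, Φ (rotate U⁻¹ (coord h)) ∂(orthHaar n) := by
  obtain ⟨V, rfl⟩ := exists_rotate_eq h E
  have : (orthHaar n).IsMulLeftInvariant := by unfold orthHaar; infer_instance
  rw [← lintegral_mul_left_eq_self (μ := orthHaar n) (fun U => Φ (rotate U⁻¹ (coord h))) V⁻¹]
  refine lintegral_congr fun U => ?_
  rw [← rotate_mul, mul_inv_rev, inv_inv]

lemma lintegral_eq_mul_of_map_rotate_eq {L : Measure (Grassmannian n k)} [SFinite L]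
    (hL : ∀ U, L.map (rotate U) = L) {Φ : Grassmannian n k → ℝ≥0∞} (hΦ : Measurable Φ) :
    ∫⁻ E, Φ E ∂L = (∫⁻ U, Φ (rotate U⁻¹ (coord h)) ∂(orthHaar n)) * L univ := by
  have hrotate (U : OrthGroup n) : ∫⁻ E, Φ (rotate U⁻¹ E) ∂L = ∫⁻ E, Φ E ∂L := by
    rw [← lintegral_map hΦ (measurable_rotate _), hL]
  calc ∫⁻ E, Φ E ∂L = ∫⁻ U, ∫⁻ E, Φ (rotate U⁻¹ E) ∂L ∂(orthHaar n) := by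
        simp only [hrotate, lintegral_const, measure_univ, mul_one]
    _ = ∫⁻ E, ∫⁻ U, Φ (rotate U⁻¹ E) ∂(orthHaar n) ∂L :=
        lintegral_lintegral_swap (hΦ.comp measurable_rotate_inv).aemeasurable
    _ = (∫⁻ U, Φ (rotate U⁻¹ (coord h)) ∂(orthHaar n)) * L univ := by
        simp only [lintegral_orthHaar_rotate_inv h, lintegral_const]

lemma eq_smul_haar_of_map_rotate_eq {L : Measure (Grassmannian n k)} [SFinite L]
    (hL : ∀ U, L.map (rotate U) = L) : L = L univ • haar h := by
  refine Measure.ext_of_lintegral _ fun Φ hΦ => ?_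
  rw [lintegral_smul_measure, smul_eq_mul, lintegral_eq_mul_of_map_rotate_eq h hL hΦ,
    lintegral_eq_mul_of_map_rotate_eq h (map_rotate_haar h) hΦ, measure_univ (μ := haar h), mul_one,
    mul_comm]

/-- The law of the range of `X`, where `X` is distributed according to Lebesgue measure on the
linear maps `ℝᵏ → ℝⁿ` with `‖A X‖ ≤ 1`. -/
def spanLaw (A : Space n ≃L[ℝ] Space n) : Measure (Grassmannian n k) :=
  ((Measure.addHaar : Measure (Hom k n)).restrict
    {X | (A : Hom n n) ∘L X ∈ Metric.closedBall 0 1}).map (span h)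

lemma lintegral_spanLaw (A : Space n ≃L[ℝ] Space n) {Φ : Grassmannian n k → ℝ≥0∞}
    (hΦ : Measurable Φ) :
    ∫⁻ E, Φ E ∂(spanLaw h A) = ∫⁻ X : Hom k n, Φ (span h X) *
      (Metric.closedBall 0 1).indicator 1 ((A : Hom n n) ∘L X) ∂Measure.addHaar := by
  have hset : MeasurableSet {X : Hom k n | (A : Hom n n) ∘L X ∈ Metric.closedBall 0 1} :=
    (continuous_const.clm_comp continuous_id).measurable measurableSet_closedBall
  rw [spanLaw, lintegral_map hΦ (measurable_span h), ← lintegral_indicator hset]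
  refine lintegral_congr fun X => ?_
  classical
  simp only [Set.indicator_apply, mem_ofPred_eq, Pi.one_apply, mul_ite, mul_one, mul_zero]

lemma spanLaw_refl_univ :
    spanLaw (k := k) h (.refl ℝ _) univ =
      (Measure.addHaar : Measure (Hom k n)) (Metric.closedBall 0 1) := by
  rw [spanLaw, Measure.map_apply (measurable_span h) .univ, preimage_univ,
    Measure.restrict_apply_univ]
  rfl

lemma map_map_spanLaw {A : Space n ≃L[ℝ] Space n} (hA : |(A : Hom n n).det| = 1) :
    (spanLaw h A).map (map A) = spanLaw (k := k) h (.refl ℝ _) := by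
  refine Measure.ext_of_lintegral _ fun Φ hΦ => ?_
  have hmap : Measurable fun E : Grassmannian n k => Φ (map A E) :=
    hΦ.comp (continuous_map h A).measurable
  have hmeas : Measurable fun X : Hom k n => Φ (span h X) *
      (Metric.closedBall 0 1).indicator 1 (((.refl ℝ _ : Space n ≃L[ℝ] Space n) : Hom n n) ∘L X) :=
    (hΦ.comp (measurable_span h)).mul (measurable_one.indicator measurableSet_closedBall)
  rw [lintegral_map hΦ (continuous_map h A).measurable, lintegral_spanLaw h A hmap,
    lintegral_spanLaw h _ hΦ, lintegral_eq_abs_det_pow_mul_lintegral_comp_left Measure.addHaar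
    (abs_ne_zero.1 (hA.trans_ne one_ne_zero)) hmeas, hA, one_pow, ENNReal.ofReal_one, one_mul]
  refine lintegral_congr_ae ?_
  filter_upwards [ae_injective (by simpa) Measure.addHaar] with X hX
  rw [span_comp_left h hX]
  rfl

lemma spanLaw_eq_withDensity (A : Space n ≃L[ℝ] Space n) :
    spanLaw h A = (spanLaw h (.refl ℝ _)).withDensity
      fun E : Grassmannian n k => (ENNReal.ofReal (jac A E ^ n))⁻¹ := by
  refine Measure.ext_of_lintegral _ fun Φ hΦ => ?_
  have hjac : Measurable fun E : Grassmannian n k => (ENNReal.ofReal (jac A E ^ n))⁻¹ :=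
    ((continuous_jac h A).pow n).measurable.ennreal_ofReal.inv
  obtain ⟨ρ, hρ_inj, hρ⟩ := exists_lintegral_mul_eq_lintegral_mul_orbitIntegral
    (U := Space k) (V := Space n) (by simpa) Measure.addHaar Measure.addHaar
  have hdisint (B : Space n ≃L[ℝ] Space n) {Θ : Grassmannian n k → ℝ≥0∞} (hΘ : Measurable Θ) :
      ∫⁻ E, Θ E ∂(spanLaw h B) = ∫⁻ X : Hom k n, Θ (span h X) * orbitIntegral Measure.addHaar
        ((Metric.closedBall 0 1).indicator 1) ((B : Hom n n) ∘L X) ∂ρ := by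
    rw [lintegral_spanLaw h B hΘ]
    refine hρ _ (fun X => (Metric.closedBall 0 1).indicator 1 ((B : Hom n n) ∘L X))
      (hΘ.comp (measurable_span h)) ?_ fun X T hT => congrArg Θ (span_comp_right h X hT)
    exact (measurable_one.indicator measurableSet_closedBall).comp
      (continuous_const.clm_comp continuous_id).measurable
  rw [lintegral_withDensity_eq_lintegral_mul _ hjac hΦ, hdisint A hΦ, hdisint _ (hjac.mul hΦ)]
  refine lintegral_congr_ae ?_
  filter_upwards [hρ_inj] with X hX
  have hjac_pos := pow_pos (jac_pos A (span h X)) n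
  change _ = (_ * _) * orbitIntegral _ _ X
  rw [orbitIntegral_closedBall Measure.addHaar (X := (A : Hom n n) ∘L X) (A.injective.comp hX),
    orbitIntegral_closedBall Measure.addHaar hX, normDet_comp_left h hX,
    finrank_euclideanSpace_fin, mul_pow, ENNReal.ofReal_mul hjac_pos.le, ENNReal.mul_inv
    (.inl (ENNReal.ofReal_pos.2 hjac_pos).ne') (.inl ENNReal.ofReal_ne_top)]
  simp only [mul_assoc, mul_left_comm]

lemma spanLaw_linearIsometryEquiv (e : Space n ≃ₗᵢ[ℝ] Space n) :
    spanLaw (k := k) h e.toContinuousLinearEquiv = spanLaw h (.refl ℝ _) := by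
  have hball : {X : Hom k n | (e.toContinuousLinearEquiv : Hom n n) ∘L X ∈ Metric.closedBall 0 1} =
      {X : Hom k n | X ∈ Metric.closedBall 0 1} := by
    ext X
    simp only [mem_ofPred_eq, mem_closedBall_zero_iff]
    exact (congrArg (· ≤ 1) e.toLinearIsometry.norm_toContinuousLinearMap_comp).to_iff
  rw [spanLaw, hball]
  rfl

lemma map_rotate_spanLaw_refl (U : OrthGroup n) :
    (spanLaw (k := k) h (.refl ℝ _)).map (rotate U) = spanLaw h (.refl ℝ _) := by
  have hdet : |((orthAct U).toContinuousLinearEquiv : Hom n n).det| = 1 :=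
    (LinearMap.normDet_eq_abs_det _).symm.trans (orthAct U).toLinearIsometry.normDet_eq_one
  have hmap := map_map_spanLaw h hdet
  rwa [spanLaw_linearIsometryEquiv] at hmap

theorem map_withDensity_haar {A : Space n ≃L[ℝ] Space n} (hA : |(A : Hom n n).det| = 1) :
    ((haar h).withDensity fun E : Grassmannian n k => (ENNReal.ofReal (jac A E ^ n))⁻¹).map
      (map A) = haar h := by
  set L := spanLaw (k := k) h (.refl ℝ _) with hL
  have hL_ne_top : L univ ≠ ∞ := by
    rw [hL, spanLaw_refl_univ]
    exact measure_closedBall_lt_top.ne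
  have hL_ne_zero : L univ ≠ 0 := by
    rw [hL, spanLaw_refl_univ]
    exact (Metric.measure_closedBall_pos _ _ one_pos).ne'
  have : IsFiniteMeasure L := ⟨hL_ne_top.lt_top⟩
  have hL_haar : L = L univ • haar h :=
    eq_smul_haar_of_map_rotate_eq h (map_rotate_spanLaw_refl h)
  have hmap : (L.withDensity fun E => (ENNReal.ofReal (jac A E ^ n))⁻¹).map (map A) = L := by
    rw [hL, ← spanLaw_eq_withDensity, map_map_spanLaw h hA]
  rw [hL_haar, withDensity_smul_measure, Measure.map_smul] at hmap
  exact Measure.ext fun s _ => (ENNReal.mul_right_inj hL_ne_zero hL_ne_top).1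
    (congrArg (fun M : Measure (Grassmannian n k) => M s) hmap)

end Grassmannian

/-! ### Affine maps -/

section AffineMaps

variable {U V : Type*} [NormedAddCommGroup U] [InnerProductSpace ℝ U] [FiniteDimensional ℝ U]
  [MeasurableSpace U] [BorelSpace U]
  [NormedAddCommGroup V] [InnerProductSpace ℝ V] [MeasurableSpace V] [BorelSpace V]

lemma restrict_range_euclideanHausdorffMeasure (X : U →L[ℝ] V) (c : V) :
    μHE[Module.finrank ℝ U].restrict (range fun u => X u + c) =
      ENNReal.ofReal X.toLinearMap.normDet • (volume : Measure U).map (fun u => X u + c) := by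
  have hmeas : Measurable fun u => X u + c := (X.continuous.add continuous_const).measurable
  ext s hs
  rw [Measure.smul_apply, Measure.map_apply hmeas hs, Measure.restrict_apply hs, smul_eq_mul,
    ← LinearMap.euclideanHausdorffMeasure_image_eq_normDet_mul_volume,
    ← (IsometryEquiv.addRight c).isometry.euclideanHausdorffMeasure_image (X.toLinearMap '' _),
    image_image, ← image_preimage_eq_inter_range]
  rfl

lemma lintegral_affineSubspace_mk' {X : U →L[ℝ] V} (hX : Function.Injective X)
    {E : Submodule ℝ V} (hE : LinearMap.range X.toLinearMap = E) (c : V) (φ : V → ℝ≥0∞) :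
    ∫⁻ x : AffineSubspace.mk' c E, φ x ∂μHE[Module.finrank ℝ U] =
      ENNReal.ofReal X.toLinearMap.normDet * ∫⁻ u, φ (X u + c) := by
  have hF : (AffineSubspace.mk' c E : Set V) = range fun u => X u + c := by
    ext x
    simp only [SetLike.mem_coe, AffineSubspace.mem_mk', ← hE, LinearMap.mem_range, vsub_eq_sub,
      eq_sub_iff_add_eq, mem_range, ContinuousLinearMap.coe_coe]
  have hemb : IsClosedEmbedding fun u => X u + c :=
    (Homeomorph.addRight c).isClosedEmbedding.comp
      (LinearMap.isClosedEmbedding_of_injective (LinearMap.ker_eq_bot.2 hX))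
  have hcoe : MeasurableEmbedding ((↑) : AffineSubspace.mk' c E → V) :=
    .subtype_coe (hF ▸ hemb.isClosed_range.measurableSet)
  have hiso : Isometry ((↑) : AffineSubspace.mk' c E → V) := isometry_subtype_coe
  have hrange : range ((↑) : AffineSubspace.mk' c E → V) = range fun u => X u + c :=
    Subtype.range_coe.trans hF
  have hmap := hiso.map_euclideanHausdorffMeasure (d := Module.finrank ℝ U)
  rw [hrange, restrict_range_euclideanHausdorffMeasure] at hmap
  rw [← hcoe.lintegral_map, hmap, lintegral_smul_measure,
    hemb.measurableEmbedding.lintegral_map, smul_eq_mul]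

end AffineMaps

section MeasurePreserving

variable {V : Type*} [NormedAddCommGroup V] [NormedSpace ℝ V] [FiniteDimensional ℝ V]

/-- The linear part of `g`, as a continuous linear equivalence. -/
def linPart (g : V ≃ᵃ[ℝ] V) : V ≃L[ℝ] V :=
  g.linear.toContinuousLinearEquiv

lemma affineEquiv_add (g : V ≃ᵃ[ℝ] V) (v z : V) : g (v + z) = linPart g v + g z :=
  g.map_vadd z v

lemma affineEquiv_symm_linPart_add (g : V ≃ᵃ[ℝ] V) (v z : V) :
    g.symm (linPart g v + z) = v + g.symm z := by
  rw [g.symm_apply_eq, affineEquiv_add, g.apply_symm_apply]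

lemma continuous_affineEquiv (g : V ≃ᵃ[ℝ] V) : Continuous g :=
  g.toContinuousAffineEquiv.continuous

variable [MeasurableSpace V] [BorelSpace V]

lemma abs_det_eq_one_of_measurePreserving {μ : Measure V} [μ.IsAddHaarMeasure] {A : V ≃L[ℝ] V}
    (hA : MeasurePreserving A μ μ) : |(A : V →L[ℝ] V).det| = 1 := by
  have hball : Measurable ((Metric.closedBall (0 : V) 1).indicator (1 : V → ℝ≥0∞)) :=
    measurable_one.indicator measurableSet_closedBall
  have hscale := lintegral_eq_abs_det_mul_lintegral_comp μ
    (L := (A : V →L[ℝ] V)) (LinearEquiv.isUnit_det' A.toLinearEquiv).ne_zero hball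
  simp only [ContinuousLinearEquiv.coe_coe, hA.lintegral_comp hball,
    lintegral_indicator_one measurableSet_closedBall] at hscale
  rw [← ENNReal.ofReal_eq_one]
  exact (ENNReal.mul_eq_right (Metric.measure_closedBall_pos _ _ one_pos).ne'
    measure_closedBall_lt_top.ne).1 hscale.symm

lemma abs_det_linPart {μ : Measure V} [μ.IsAddHaarMeasure] {g : V ≃ᵃ[ℝ] V}
    (hg : MeasurePreserving g μ μ) : |(linPart g : V →L[ℝ] V).det| = 1 := by
  have hlin : (fun x => x + -g 0) ∘ g = linPart g := by
    ext1 v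
    have hv := affineEquiv_add g v 0
    rw [add_zero] at hv
    simp only [Function.comp_apply, hv, add_neg_cancel_right]
  exact abs_det_eq_one_of_measurePreserving
    (hlin ▸ (measurePreserving_add_right μ (-g 0)).comp hg)

end MeasurePreserving

section OrthogonalFibres

variable {V : Type*} [NormedAddCommGroup V] [InnerProductSpace ℝ V] [FiniteDimensional ℝ V]
  [MeasurableSpace V] [BorelSpace V]

lemma lintegral_eq_lintegral_orthogonal (E : Submodule ℝ V) {f : V → ℝ≥0∞} (hf : Measurable f) :
    ∫⁻ z, f z = ∫⁻ x : Eᗮ, ∫⁻ v : E, f (v + x) := by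
  have hprod := (E.measurePreserving_measurableEquivProd (0 : V)).symm
  rw [InnerProductSpace.euclideanHausdorffMeasure_eq_volume] at hprod
  rw [← hprod.lintegral_comp hf, Measure.volume_eq_prod,
    lintegral_prod_symm (fun q => f ((E.measurableEquivProd 0).symm q))
      (hf.comp (MeasurableEquiv.measurable _)).aemeasurable]
  simp only [Submodule.measurableEquivProd_symm_apply, vadd_eq_add, add_zero]

lemma lintegral_mul_eq_of_add_invariant {E : Submodule ℝ V} {φ H : V → ℝ≥0∞} (hφ : Measurable φ)
    (hH : Measurable H) (hinv : ∀ v ∈ E, ∀ z, H (v + z) = H z) :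
    ∫⁻ z, φ z * H z = ∫⁻ x : Eᗮ, (∫⁻ v : E, φ (v + x)) * H x := by
  rw [lintegral_eq_lintegral_orthogonal E (f := fun z => φ z * H z) (hφ.mul hH)]
  refine lintegral_congr fun x => ?_
  simp only [hinv _ (Subtype.prop _)]
  exact lintegral_mul_const _ (by fun_prop)

lemma exists_lintegral_add_eq_one (E : Submodule ℝ V) :
    ∃ φ : V → ℝ≥0∞, Measurable φ ∧ ∀ z, ∫⁻ v : E, φ (v + z) = 1 := by
  let ψ : E → ℝ≥0∞ := fun v =>
    (volume (Metric.closedBall (0 : E) 1))⁻¹ * (Metric.closedBall 0 1).indicator 1 v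
  have hψ : Measurable ψ := (measurable_one.indicator measurableSet_closedBall).const_mul _
  refine ⟨fun z => ψ (E.orthogonalProjectionOnto z),
    hψ.comp E.orthogonalProjectionOnto.continuous.measurable, fun z => ?_⟩
  simp only [map_add, Submodule.orthogonalProjectionOnto_mem_subspace_eq_self]
  rw [lintegral_add_right_eq_self ψ, lintegral_const_mul _
    (measurable_one.indicator measurableSet_closedBall),
    lintegral_indicator_one measurableSet_closedBall]
  exact ENNReal.inv_mul_cancel (Metric.measure_closedBall_pos _ _ one_pos).ne'
    measure_closedBall_lt_top.ne

lemma lintegral_submodule_map_add (A : V ≃L[ℝ] V) (E : Submodule ℝ V) (φ : V → ℝ≥0∞) (y : V) :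
    ∫⁻ w : E.map A.toLinearEquiv.toLinearMap, φ (w + y) =
      ENNReal.ofReal (A.toLinearEquiv.toLinearMap.domRestrict E).normDet *
        ∫⁻ v : E, φ (A v + y) := by
  have hmap := lintegral_affineSubspace_mk' (X := (A : V →L[ℝ] V) ∘L E.subtypeL)
    (A.injective.comp Subtype.val_injective) (LinearMap.range_domRestrict E _) y φ
  have himage := lintegral_affineSubspace_mk'
    (X := (E.map A.toLinearEquiv.toLinearMap).subtypeL) Subtype.val_injective
    (Submodule.range_subtype _) y φ
  rw [Submodule.toLinearMap_subtypeL, LinearMap.normDet_subtype, ENNReal.ofReal_one, one_mul,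
    LinearEquiv.finrank_map_eq] at himage
  exact himage.symm.trans hmap

-- With `φ` of integral `1` along every translate of `E`, integrate `φ (g⁻¹ w) * H w` along the
-- translates of `g E`, and, after the substitution `w = g z`, along those of `E`.
lemma lintegral_orthogonal_comp_affineEquiv {g : V ≃ᵃ[ℝ] V}
    (hg : MeasurePreserving g volume volume) (E : Submodule ℝ V) {H : V → ℝ≥0∞}
    (hH : Measurable H)
    (hinv : ∀ w ∈ E.map (linPart g).toLinearEquiv.toLinearMap, ∀ z, H (w + z) = H z) :
    ∫⁻ x : Eᗮ, H (g x) =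
      ENNReal.ofReal ((linPart g).toLinearEquiv.toLinearMap.domRestrict E).normDet *
        ∫⁻ y : (E.map (linPart g).toLinearEquiv.toLinearMap)ᗮ, H y := by
  obtain ⟨φ, hφ, hφ_one⟩ := exists_lintegral_add_eq_one E
  have hφg : Measurable fun w => φ (g.symm w) := hφ.comp (continuous_affineEquiv g.symm).measurable
  have hHg : Measurable fun z => H (g z) := hH.comp hg.measurable
  have hinv_g (v : V) (hv : v ∈ E) (z : V) : H (g (v + z)) = H (g z) := by
    rw [affineEquiv_add]
    exact hinv _ (Submodule.mem_map_of_mem hv) _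
  have hsource := lintegral_mul_eq_of_add_invariant hφ hHg hinv_g
  have htarget := lintegral_mul_eq_of_add_invariant hφg hH hinv
  rw [← hg.lintegral_comp (f := fun w => φ (g.symm w) * H w) (hφg.mul hH)] at htarget
  simp only [AffineEquiv.symm_apply_apply] at htarget
  simp only [hφ_one, one_mul] at hsource
  simp only [lintegral_submodule_map_add _ _ fun w => φ (g.symm w), affineEquiv_symm_linPart_add,
    hφ_one, mul_one] at htarget
  rw [lintegral_const_mul _ (by fun_prop)] at htarget
  exact hsource.symm.trans htarget

end OrthogonalFibres

/-! ### Affine maps acting on the affine Grassmannian -/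

lemma inv_ofReal_pow_succ_mul {a : ℝ} (ha : 0 < a) (d : ℕ) (x : ℝ≥0∞) :
    (ENNReal.ofReal (a ^ (d + 1)))⁻¹ * (ENNReal.ofReal a * x) =
      (ENNReal.ofReal (a ^ d))⁻¹ * x := by
  rw [← mul_assoc, pow_succ, ENNReal.ofReal_mul (by positivity),
    ENNReal.mul_inv (.inr ENNReal.ofReal_ne_top) (.inl ENNReal.ofReal_ne_top), mul_assoc _ _⁻¹,
    ENNReal.inv_mul_cancel (ENNReal.ofReal_pos.2 ha).ne' ENNReal.ofReal_ne_top, mul_one]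

namespace AffineGrassmannian

variable {n k : ℕ}

/-- The image of an affine subspace under an affine transformation. -/
def map (g : Space n ≃ᵃ[ℝ] Space n) (F : AffineGrassmannian n k) : AffineGrassmannian n k :=
  ⟨F.1.map g.toAffineMap, by
    rw [AffineSubspace.coe_map]
    exact F.2.1.image _, by
    rw [AffineSubspace.map_direction]
    exact (LinearEquiv.finrank_map_eq g.linear F.1.direction).trans F.2.2⟩

lemma map_mk (g : Space n ≃ᵃ[ℝ] Space n) (E : Grassmannian n k) (z : Space n) :
    map g (mk E z) = mk (E.map (linPart g)) (g z) :=
  Subtype.ext (AffineSubspace.map_mk' _ _ _)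

lemma mk_dir_foot (F : AffineGrassmannian n k) : mk F.dir F.foot = F := by
  have : Nonempty F.1 := F.2.1.to_subtype
  exact Subtype.ext (AffineSubspace.mk'_eq (EuclideanGeometry.orthogonalProjection F.1 0).2)

lemma mk_add {E : Grassmannian n k} {v : Space n} (hv : v ∈ E.1) (z : Space n) :
    mk E (v + z) = mk E z := by
  refine Subtype.ext (AffineSubspace.ext_of_direction_eq ?_ ⟨v + z, ?_, ?_⟩)
  · simp only [mk, AffineSubspace.direction_mk']
  · exact AffineSubspace.self_mem_mk' _ _
  · simpa [mk] using hv

lemma map_symm_map (g : Space n ≃ᵃ[ℝ] Space n) (F : AffineGrassmannian n k) :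
    map g.symm (map g F) = F := by
  refine Subtype.ext ((AffineSubspace.map_map _ _ _).trans ?_)
  change F.1.map (g.trans g.symm).toAffineMap = F.1
  rw [g.self_trans_symm]
  exact AffineSubspace.map_id _

lemma continuous_dir : Continuous (dir : AffineGrassmannian n k → _) :=
  continuous_fst.comp
    (continuous_induced_dom (f := fun F : AffineGrassmannian n k => (F.dir, F.foot)))

lemma continuous_foot : Continuous (foot : AffineGrassmannian n k → _) :=
  continuous_snd.comp
    (continuous_induced_dom (f := fun F : AffineGrassmannian n k => (F.dir, F.foot)))

lemma measurable_map (h : k ≤ n) (g : Space n ≃ᵃ[ℝ] Space n) :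
    Measurable (map g : AffineGrassmannian n k → _) := by
  have hmap : (map g : AffineGrassmannian n k → _) =
      fun F => mk (F.dir.map (linPart g)) (g F.foot) :=
    funext fun F => (congrArg (map g) F.mk_dir_foot.symm).trans (map_mk g _ _)
  rw [hmap]
  exact measurable_mk.comp (((Grassmannian.continuous_map h (linPart g)).comp
    continuous_dir).prodMk ((continuous_affineEquiv g).comp continuous_foot)).measurable

/-- The action of an affine transformation on the affine Grassmannian. -/
def mapEquiv (h : k ≤ n) (g : Space n ≃ᵃ[ℝ] Space n) :
    AffineGrassmannian n k ≃ᵐ AffineGrassmannian n k where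
  toFun := map g
  invFun := map g.symm
  left_inv := map_symm_map g
  right_inv := map_symm_map g.symm
  measurable_toFun := measurable_map h g
  measurable_invFun := measurable_map h g.symm

lemma measurable_mk_right (E : Grassmannian n k) : Measurable (mk E) :=
  measurable_mk.comp measurable_prodMk_left

lemma lintegral_orthogonal_map {g : Space n ≃ᵃ[ℝ] Space n} (hg : MeasurePreserving g volume volume)
    (E : Grassmannian n k) {G : AffineGrassmannian n k → ℝ≥0∞} (hG : Measurable G) :
    ∫⁻ x : E.1ᗮ, G (map g (mk E x)) = ENNReal.ofReal (E.jac (linPart g)) *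
      ∫⁻ y : (E.map (linPart g)).1ᗮ, G (mk (E.map (linPart g)) y) := by
  simp only [map_mk]
  exact lintegral_orthogonal_comp_affineEquiv hg E.1 (hG.comp (measurable_mk_right _))
    fun w hw z => congrArg G (mk_add hw z)

lemma lintegral_measure (h : k ≤ n) {G : AffineGrassmannian n k → ℝ≥0∞} (hG : Measurable G) :
    ∫⁻ F, G F ∂(measure h) = ∫⁻ E, (∫⁻ x : E.1ᗮ, G (mk E x)) ∂(Grassmannian.haar h) := by
  rw [measure, Measure.lintegral_bind measurable_kernel.aemeasurable hG.aemeasurable]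
  exact lintegral_congr fun E =>
    lintegral_map hG ((measurable_mk_right E).comp measurable_subtype_coe)

lemma measurable_lintegral_orthogonal {G : AffineGrassmannian n k → ℝ≥0∞} (hG : Measurable G) :
    Measurable fun E : Grassmannian n k => ∫⁻ x : E.1ᗮ, G (mk E x) := by
  have hmap (E : Grassmannian n k) : ∫⁻ x : E.1ᗮ, G (mk E x) =
      ∫⁻ F, G F ∂((volume : Measure E.1ᗮ).map fun x : E.1ᗮ => mk E (x : Space n)) :=
    (lintegral_map hG ((measurable_mk_right E).comp measurable_subtype_coe)).symm
  simp only [hmap]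
  exact (Measure.measurable_lintegral hG).comp measurable_kernel

lemma measurable_inv_jac_pow (h : k ≤ n) (A : Space n ≃L[ℝ] Space n) (d : ℕ) :
    Measurable fun F : AffineGrassmannian n k => (ENNReal.ofReal (F.dir.jac A ^ d))⁻¹ :=
  (((Grassmannian.continuous_jac h A).comp continuous_dir).pow d).measurable.ennreal_ofReal.inv

-- The density `J ^ (-n)` of `map_withDensity_haar` acquires one more factor `J⁻¹` from the
-- orthogonal complements.
theorem map_withDensity_measure (h : k ≤ n) {g : Space n ≃ᵃ[ℝ] Space n}
    (hg : MeasurePreserving g volume volume) :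
    ((measure h).withDensity fun F : AffineGrassmannian n k =>
      (ENNReal.ofReal (F.dir.jac (linPart g) ^ (n + 1)))⁻¹).map (map g) = measure h := by
  refine Measure.ext_of_lintegral _ fun G hG => ?_
  have hGmap : Measurable fun F => G (map g F) := hG.comp (measurable_map h g)
  have hdens := measurable_inv_jac_pow (k := k) h (linPart g) (n + 1)
  have hjac : Measurable fun E : Grassmannian n k =>
      (ENNReal.ofReal (E.jac (linPart g) ^ n))⁻¹ :=
    ((Grassmannian.continuous_jac h (linPart g)).pow n).measurable.ennreal_ofReal.inv
  have hmap := (Grassmannian.continuous_map (k := k) h (linPart g)).measurable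
  have hfibre := measurable_lintegral_orthogonal hG
  have hfibre_map : Measurable fun E : Grassmannian n k =>
      ∫⁻ y : (E.map (linPart g)).1ᗮ, G (mk (E.map (linPart g)) y) := hfibre.comp hmap
  rw [lintegral_map hG (measurable_map h g), lintegral_withDensity_eq_lintegral_mul _ hdens hGmap,
    lintegral_measure h (hdens.mul hGmap), lintegral_measure h hG]
  conv_rhs => rw [← Grassmannian.map_withDensity_haar h (abs_det_linPart hg),
    lintegral_map hfibre hmap, lintegral_withDensity_eq_lintegral_mul _ hjac hfibre_map]
  refine lintegral_congr fun E => ?_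
  have hGE : Measurable fun x : E.1ᗮ => G (map g (mk E x)) :=
    hGmap.comp ((measurable_mk_right E).comp measurable_subtype_coe)
  simp only [Pi.mul_apply, dir_mk]
  refine (lintegral_const_mul _ hGE).trans ?_
  rw [lintegral_orthogonal_map hg E hG]
  exact inv_ofReal_pow_succ_mul (E.jac_pos _) n _

end AffineGrassmannian

section PlaneNorm

variable {n k m : ℕ} {𝕜 : Type*} [RCLike 𝕜]

lemma AffineGrassmannian.lintegral_comp_symm_map (g : Space n ≃ᵃ[ℝ] Space n)
    (F : AffineGrassmannian n k) (φ : Space n → ℝ≥0∞) :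
    ∫⁻ x : (F.map g).1, φ (g.symm x) ∂μHE[k] =
      ENNReal.ofReal (F.dir.jac (linPart g)) * ∫⁻ x : F.1, φ x ∂μHE[k] := by
  suffices ∀ (E : Grassmannian n k) (z : Space n),
      ∫⁻ x : (map g (mk E z)).1, φ (g.symm x) ∂μHE[k] =
        ENNReal.ofReal (E.jac (linPart g)) * ∫⁻ x : (mk E z).1, φ x ∂μHE[k] by
    have hF := this F.dir F.foot
    rwa [mk_dir_foot] at hF
  intro E z
  have himage := lintegral_affineSubspace_mk'
    (X := (linPart g : Space n →L[ℝ] Space n) ∘L E.1.subtypeL)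
    ((linPart g).injective.comp Subtype.val_injective) (LinearMap.range_domRestrict E.1 _) (g z)
    fun x => φ (g.symm x)
  rw [E.2] at himage
  have hsource := lintegral_affineSubspace_mk' (X := E.1.subtypeL) Subtype.val_injective
    (Submodule.range_subtype E.1) z φ
  rw [Submodule.toLinearMap_subtypeL, LinearMap.normDet_subtype, ENNReal.ofReal_one,
    one_mul, E.2] at hsource
  rw [map_mk]
  refine himage.trans (congrArg _ (Eq.trans ?_ hsource.symm))
  simp only [ContinuousLinearMap.comp_apply, ContinuousLinearEquiv.coe_coe,
    affineEquiv_symm_linPart_add, g.symm_apply_apply, Submodule.subtypeL_apply]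

lemma ofReal_mul_rpow {a : ℝ} (ha : 0 < a) (x : ℝ≥0∞) (z : ℝ) :
    (ENNReal.ofReal a * x) ^ z = ENNReal.ofReal (a ^ z) * x ^ z := by
  simp only [ENNReal.mul_rpow_eq_ite, ENNReal.ofReal_rpow_of_pos ha, ENNReal.ofReal_ne_top,
    (ENNReal.ofReal_pos.2 ha).ne', false_and, or_self, if_false]

lemma planeNorm_rpow {p : ℝ} (hp : p ≠ 0) (f : Space n → 𝕜) (F : AffineGrassmannian n k) (α : ℝ) :
    planeNorm f p F ^ α = (∫⁻ x : F.1, ‖f x‖ₑ ^ p ∂μHE[k]) ^ (α / p) := by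
  have hpow : planeNorm f p F ^ p = ∫⁻ x : F.1, ‖f x‖ₑ ^ p ∂μHE[k] := by
    rw [planeNorm, eLpNorm', ← ENNReal.rpow_mul, one_div_mul_cancel hp, ENNReal.rpow_one]
    rfl
  rw [← hpow, ← ENNReal.rpow_mul, mul_div_cancel₀ _ hp]

lemma prod_planeNorm_rpow_map {p : Fin m → ℝ} (hp : ∀ i, p i ≠ 0) (α : Fin m → ℝ)
    (f : Fin m → Space n → 𝕜) (g : Space n ≃ᵃ[ℝ] Space n) (F : AffineGrassmannian n k) :
    ∏ i, planeNorm (fun t => f i (g.symm t)) (p i) (F.map g) ^ α i =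
      ENNReal.ofReal (F.dir.jac (linPart g) ^ ∑ i, α i / p i) *
        ∏ i, planeNorm (f i) (p i) F ^ α i := by
  have hJ : 0 < F.dir.jac (linPart g) := F.dir.jac_pos _
  have hfactor (i : Fin m) : planeNorm (fun t => f i (g.symm t)) (p i) (F.map g) ^ α i =
      ENNReal.ofReal (F.dir.jac (linPart g) ^ (α i / p i)) * planeNorm (f i) (p i) F ^ α i := by
    rw [planeNorm_rpow (hp i), planeNorm_rpow (hp i),
      F.lintegral_comp_symm_map g fun x => ‖f i x‖ₑ ^ p i, ofReal_mul_rpow hJ]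
  simp only [hfactor]
  rw [Finset.prod_mul_distrib, Real.rpow_sum_of_pos hJ,
    ENNReal.ofReal_prod_of_nonneg fun i _ => (Real.rpow_pos_of_pos hJ _).le]

end PlaneNorm

end AffineGrass

end

theorem mainTheorem5_general {n k m : ℕ} (hkn : k ≤ n)
    {𝕜 : Type*} [RCLike 𝕜] (p α : Fin m → ℝ) (hp : ∀ i, p i ≠ 0)
    (f : Fin m → AffineGrass.Space n → 𝕜)
    (hsum : ∑ i, α i / p i = (n : ℝ) + 1)
    (g : AffineGrass.Space n ≃ᵃ[ℝ] AffineGrass.Space n)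
    (hg : MeasurePreserving g volume volume) :
    AffineGrass.affineFunctional hkn p α (fun i t => f i (g.symm t)) =
      AffineGrass.affineFunctional hkn p α f := by
  have hJ (F : AffineGrass.AffineGrassmannian n k) :
      0 < ENNReal.ofReal (F.dir.jac (AffineGrass.linPart g) ^ (n + 1)) :=
    ENNReal.ofReal_pos.2 (pow_pos (F.dir.jac_pos _) _)
  have hprod (F : AffineGrass.AffineGrassmannian n k) :
      ∏ i, AffineGrass.planeNorm (fun t => f i (g.symm t)) (p i) (F.map g) ^ α i =
        ENNReal.ofReal (F.dir.jac (AffineGrass.linPart g) ^ (n + 1)) *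
          ∏ i, AffineGrass.planeNorm (f i) (p i) F ^ α i := by
    rw [AffineGrass.prod_planeNorm_rpow_map hp, hsum]
    norm_cast
  unfold AffineGrass.affineFunctional
  conv_lhs => rw [← AffineGrass.AffineGrassmannian.map_withDensity_measure hkn hg]
  refine (lintegral_map_equiv _ (AffineGrass.AffineGrassmannian.mapEquiv hkn g)).trans ?_
  rw [lintegral_withDensity_eq_lintegral_mul_non_measurable _
    (AffineGrass.AffineGrassmannian.measurable_inv_jac_pow hkn _ _)
    (ae_of_all _ fun F => ENNReal.inv_lt_top.2 (hJ F))]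
  refine lintegral_congr fun F => (congrArg (_ * ·) (hprod F)).trans ?_
  rw [← mul_assoc, ENNReal.inv_mul_cancel (hJ F).ne' ENNReal.ofReal_ne_top, one_mul]

theorem mainTheorem5 {n k m : ℕ} (hk : 1 ≤ k) (hkn : k ≤ n) (hm : 0 < m)
    {𝕜 : Type*} [RCLike 𝕜] (p α : Fin m → ℝ) (hp : ∀ i, p i ≠ 0)
    (f : Fin m → AffineGrass.Space n → 𝕜)
    (hf_meas : ∀ i, AEStronglyMeasurable (f i) volume)
    (hf_bdd : ∀ i, ∃ C : ℝ, ∀ x, ‖f i x‖ ≤ C)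
    (hf_Lp : ∀ i, ∫⁻ x, ‖f i x‖ₑ ^ p i < ∞)
    (hsum : ∑ i, α i / p i = (n : ℝ) + 1)
    (hfin : AffineGrass.affineFunctional hkn p α f < ∞)
    (g : AffineGrass.Space n ≃ᵃ[ℝ] AffineGrass.Space n)
    (hg : MeasurePreserving g volume volume) :
    AffineGrass.affineFunctional hkn p α (fun i t => f i (g.symm t)) =
      AffineGrass.affineFunctional hkn p α f :=
  mainTheorem5_general hkn p α hp f hsum g hg
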